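/- For $S\subseteq\mathbb{R}^n$ and $d>0$, let $G(S,d)$ be the graph with vertex set $S$ in which two points are adjacent if and only if their Euclidean distance is $d$. Say that $d>0$ is realized in $S$ if two points of $S$ are at distance $d$. The isomorphism classes of distance graphs on $S$ are the classes of the equivalence relation on $(0,\infty)$ under which $d$ and $d'$ are equivalent if and only if $G(S,d)$ and $G(S,d')$ are isomorphic; a class is non-trivial if it contains a distance realized in $S$. **Theorem.** Let $d_1\neq d_2$ be positive real numbers, both realized as distances between points of the integer lattice $\mathbb{Z}^2\subset\mathbb{R}^2$. Then the graphs $G(\mathbb{Z}^2,d_1)$ and $G(\mathbb{Z}^2,d_2)$ are not isomorphic. Consequently, every non-trivial isomorphism class of distance graphs on $\mathbb{Z}^2$ consists of a single distance. -/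

import Mathlib

/-- The distance graph `G(S, d)`: its vertices are the points of `S ⊆ ℝⁿ`, two distinct points being
adjacent iff they are at Euclidean distance `d`. (For `d > 0` the condition `x ≠ y` is automatic.) -/
def distanceGraph {n : ℕ} (S : Set (EuclideanSpace ℝ (Fin n))) (d : ℝ) : SimpleGraph S where
  Adj x y := x ≠ y ∧ dist (x : EuclideanSpace ℝ (Fin n)) (y : EuclideanSpace ℝ (Fin n)) = d
  symm := ⟨fun _ _ h => ⟨h.1.symm, by rw [dist_comm]; exact h.2⟩⟩
  loopless := ⟨fun _ h => h.1 rfl⟩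

/-- `d` is a positive real number realized as a distance between two points of `S`. -/
def IsRealizedDistance {n : ℕ} (S : Set (EuclideanSpace ℝ (Fin n))) (d : ℝ) : Prop :=
  0 < d ∧ ∃ x ∈ S, ∃ y ∈ S, dist x y = d

/-- The integer lattice `ℤⁿ` as a subset of Euclidean space `ℝⁿ`. -/
def integerLattice (n : ℕ) : Set (EuclideanSpace ℝ (Fin n)) :=
  {x | ∀ i, ∃ m : ℤ, x i = (m : ℝ)}

/-- `P ⊆ (0, ∞)` is an isomorphism class of distance graphs on `S`: the set of all positive `d'` with
`G(S, d')` isomorphic to `G(S, d)`, for some `d > 0`. -/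
def IsDistanceIsoClass {n : ℕ} (S : Set (EuclideanSpace ℝ (Fin n))) (P : Set ℝ) : Prop :=
  ∃ d : ℝ, 0 < d ∧
    P = {d' : ℝ | 0 < d' ∧ Nonempty (distanceGraph S d ≃g distanceGraph S d')}

/-! A graph isomorphism gives a bijection `e` of `ℤ²` carrying squared distance `N` exactly to `N'`.
It preserves straight continuation of edges (`add_add_sub`), hence parallelism of edges
(`add_sub_eq`); so, once `e 0 = 0`, it is additive on the subgroup generated by the vectors of
squared length `N`. It also matches the cosets of this subgroup with those of its counterpart for
`N'`, so the two indices agree and `e` preserves covolumes of sublattices. A square on a vector of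
squared length `N` has area `N`; its image is a parallelogram of area `N` with sides `√N'`, whence
`N ≤ N'`. The inverse of `e` gives equality. -/

/-- The squared Euclidean length of a vector of the lattice `ℤ²`. -/
def latticeNormSq (x : Fin 2 → ℤ) : ℤ := x 0 ^ 2 + x 1 ^ 2

theorem latticeNormSq_neg (x : Fin 2 → ℤ) : latticeNormSq (-x) = latticeNormSq x := by
  simp [latticeNormSq]

theorem latticeNormSq_eq_zero {x : Fin 2 → ℤ} (h : latticeNormSq x = 0) : x = 0 := by
  unfold latticeNormSq at h
  have h0 : x 0 = 0 := by nlinarith [sq_nonneg (x 0), sq_nonneg (x 1)]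
  have h1 : x 1 = 0 := by nlinarith [sq_nonneg (x 0), sq_nonneg (x 1)]
  ext i
  fin_cases i
  · exact h0
  · exact h1

/-- Parallelogram law in the lattice. -/
theorem latticeNormSq_parallelogram (u s : Fin 2 → ℤ) :
    latticeNormSq u + latticeNormSq (u - s - s) =
      2 * latticeNormSq (u - s) + 2 * latticeNormSq s := by
  simp only [latticeNormSq, Pi.sub_apply]
  ring

/-- A bijection of `ℤ²` carrying the pairs at squared distance `N` exactly onto the pairs at squared
distance `N'`. -/
def CarriesNormSq (e : (Fin 2 → ℤ) ≃ (Fin 2 → ℤ)) (N N' : ℤ) : Prop :=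
  ∀ x y, latticeNormSq (x - y) = N ↔ latticeNormSq (e x - e y) = N'

/-- The subgroup of `ℤ²` generated by the vectors of squared length `N`. -/
def normSqSubgroup (N : ℤ) : AddSubgroup (Fin 2 → ℤ) :=
  AddSubgroup.closure {s | latticeNormSq s = N}

namespace CarriesNormSq

variable {e : (Fin 2 → ℤ) ≃ (Fin 2 → ℤ)} {N N' : ℤ}

theorem symm (h : CarriesNormSq e N N') : CarriesNormSq e.symm N' N := fun x y => by
  rw [h]
  simp

theorem add_sub (h : CarriesNormSq e N N') {s : Fin 2 → ℤ} (hs : latticeNormSq s = N)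
    (x : Fin 2 → ℤ) : latticeNormSq (e (x + s) - e x) = N' := by
  rw [← h]
  simpa using hs

/-- Edges that continue each other in a straight line are mapped to such edges: the midpoint is the
only common neighbour of the two ends. -/
theorem add_add_sub (h : CarriesNormSq e N N') {s : Fin 2 → ℤ} (hs : latticeNormSq s = N)
    (x : Fin 2 → ℤ) : e (x + s + s) - e (x + s) = e (x + s) - e x := by
  -- The fourth vertex of the parallelogram on the two image edges: a common neighbour of `e x` and
  -- `e (x + s + s)`, so `y` must be the midpoint `x + s`.
  obtain ⟨y, hy⟩ := e.surjective (e x + (e (x + s + s) - e (x + s)))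
  have h₁ : latticeNormSq (y - x) = N := by
    rw [h, hy, add_sub_cancel_left]
    exact h.add_sub hs _
  have h₂ : latticeNormSq (y - x - s - s) = N := by
    have : y - x - s - s = y - (x + s + s) := by abel
    rw [this, h, hy, ← latticeNormSq_neg, ← h.add_sub hs x]
    congr 1
    abel
  have h₃ := latticeNormSq_parallelogram (y - x) s
  have h₄ : y = x + s := by
    have := latticeNormSq_eq_zero (x := y - x - s) (by linarith)
    rw [sub_sub, sub_eq_zero] at this
    exact this
  rw [h₄] at hy
  exact sub_eq_iff_eq_add'.mpr hy |>.symm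

/-- Parallel edges with adjacent starting points have parallel images. -/
theorem add_sub_eq (h : CarriesNormSq e N N') {s t : Fin 2 → ℤ} (hs : latticeNormSq s = N)
    (ht : latticeNormSq t = N) (x : Fin 2 → ℤ) : e (x + t + s) - e (x + t) = e (x + s) - e x := by
  have a₁ := h.add_add_sub hs x
  have a₂ := h.add_add_sub hs (x + t)
  have b₀ := h.add_sub ht x
  have b₁ := h.add_sub ht (x + s)
  have b₂ := h.add_sub ht (x + s + s)
  rw [show x + s + t = x + t + s by abel] at b₁
  rw [show x + s + s + t = x + t + s + s by abel] at b₂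
  set D := e (x + t + s) - e (x + t) - (e (x + s) - e x) with hD
  set c := e (x + t) - e x
  have c₁ : e (x + t + s) - e (x + s) = c + D := by simp only [c, hD]; abel
  have c₂ : e (x + t + s + s) - e (x + s + s) = c + D + D := by
    rw [sub_eq_iff_eq_add] at a₁ a₂
    rw [a₁, a₂]
    simp only [c, hD]
    abel
  rw [c₁] at b₁
  rw [c₂] at b₂
  -- `c`, `c + D`, `c + D + D` are collinear and equally long, and a line meets a circle at most
  -- twice.
  have p := latticeNormSq_parallelogram (c + D + D) D
  have hz : D = 0 := by
    apply latticeNormSq_eq_zero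
    simp only [add_sub_cancel_right] at p
    linarith
  exact sub_eq_zero.mp hz

theorem add_sub_mem (h : CarriesNormSq e N N') {y : Fin 2 → ℤ} (hy : y ∈ normSqSubgroup N) :
    ∀ x, e (x + y) - e x ∈ normSqSubgroup N' := by
  induction hy using AddSubgroup.closure_induction with
  | mem s hs => exact fun x => AddSubgroup.subset_closure (h.add_sub hs x)
  | zero => simp [zero_mem]
  | add y z _ _ hy hz =>
    intro x
    have := add_mem (hz (x + y)) (hy x)
    rwa [sub_add_sub_cancel, add_assoc] at this
  | neg y _ hy =>
    intro x
    have := neg_mem (hy (x + -y))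
    rwa [neg_sub, neg_add_cancel_right] at this

theorem add_sub_eq_of_mem (h : CarriesNormSq e N N') {s y : Fin 2 → ℤ} (hs : latticeNormSq s = N)
    (hy : y ∈ normSqSubgroup N) : ∀ x, e (x + y + s) - e (x + y) = e (x + s) - e x := by
  induction hy using AddSubgroup.closure_induction with
  | mem t ht => exact fun x => h.add_sub_eq hs ht x
  | zero => simp
  | add y z _ _ hy hz =>
    intro x
    rw [← add_assoc, hz, hy]
  | neg y _ hy =>
    intro x
    have := hy (x + -y)
    rw [neg_add_cancel_right] at this
    exact this.symm

theorem map_add_of_mem (h : CarriesNormSq e N N') (h0 : e 0 = 0) {y : Fin 2 → ℤ}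
    (hy : y ∈ normSqSubgroup N) : ∀ x ∈ normSqSubgroup N, e (x + y) = e x + e y := by
  induction hy using AddSubgroup.closure_induction with
  | mem s hs =>
    intro x hx
    have := h.add_sub_eq_of_mem hs hx 0
    rw [zero_add, zero_add, h0, sub_zero, sub_eq_iff_eq_add'] at this
    exact this
  | zero => simp [h0]
  | add y z hy' _ hy hz =>
    intro x hx
    rw [← add_assoc, hz _ (add_mem hx hy'), hy x hx, hz y hy', add_assoc]
  | neg y hy' hy =>
    intro x hx
    have h₁ := hy (x + -y) (add_mem hx (neg_mem hy'))
    have h₂ := hy (-y) (neg_mem hy')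
    rw [neg_add_cancel_right] at h₁
    rw [neg_add_cancel, h0] at h₂
    rw [h₁, add_assoc, add_comm (e y), ← h₂, add_zero]

/-- Both `e` and its inverse send cosets into cosets. -/
theorem index_eq (h : CarriesNormSq e N N') :
    (normSqSubgroup N).index = (normSqSubgroup N').index := by
  refine Nat.card_congr (Quotient.congr e fun x y => ?_)
  rw [QuotientAddGroup.leftRel_apply, QuotientAddGroup.leftRel_apply]
  constructor
  · intro hxy
    have := h.add_sub_mem hxy x
    rwa [add_neg_cancel_left, sub_eq_neg_add] at this
  · intro hxy
    have := h.symm.add_sub_mem hxy (e x)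
    rwa [add_neg_cancel_left, sub_eq_neg_add, e.symm_apply_apply, e.symm_apply_apply] at this

/-- The restriction to `normSqSubgroup N` as a group homomorphism. -/
def restrictHom (h : CarriesNormSq e N N') (h0 : e 0 = 0) :
    normSqSubgroup N →+ (Fin 2 → ℤ) :=
  AddMonoidHom.mk' (fun x => e x) fun x y => h.map_add_of_mem h0 y.2 x x.2

theorem restrictHom_injective (h : CarriesNormSq e N N') (h0 : e 0 = 0) :
    Function.Injective (h.restrictHom h0) := fun _ _ hxy => Subtype.ext (e.injective hxy)

theorem range_restrictHom (h : CarriesNormSq e N N') (h0 : e 0 = 0) :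
    (h.restrictHom h0).range = normSqSubgroup N' := by
  ext y
  constructor
  · rintro ⟨x, rfl⟩
    have := h.add_sub_mem x.2 0
    rwa [zero_add, h0, sub_zero] at this
  · intro hy
    have := h.symm.add_sub_mem hy 0
    rw [zero_add, e.symm_apply_eq.mpr h0.symm, sub_zero] at this
    exact ⟨⟨_, this⟩, e.apply_symm_apply y⟩

end CarriesNormSq

theorem index_closure_pair {u w : Fin 2 → ℤ} (h : LinearIndependent ℤ ![u, w]) :
    (AddSubgroup.closure {u, w}).index = (u 0 * w 1 - u 1 * w 0).natAbs := by
  have hcl : (Submodule.span ℤ (Set.range ![u, w])).toAddSubgroup =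
      AddSubgroup.closure {u, w} := by
    rw [Submodule.span_int_eq_addSubgroupClosure, Matrix.range_cons, Matrix.range_cons,
      Matrix.range_empty, Set.union_empty]
    rfl
  rw [← hcl, AddSubgroup.index_eq_natAbs_det (Pi.basisFun ℤ (Fin 2)) _ (Module.Basis.span h)]
  have : (fun i => ((Module.Basis.span h i : Submodule.span ℤ (Set.range ![u, w])) : Fin 2 → ℤ)) =
      ![u, w] := by
    ext i
    rw [Module.Basis.span_apply]
  erw [this]
  rw [Pi.basisFun_det_apply, Matrix.det_fin_two]
  simp

/-! ### Comparison of areas -/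

namespace CarriesNormSq

variable {e : (Fin 2 → ℤ) ≃ (Fin 2 → ℤ)} {N N' : ℤ}

theorem le_of_map_zero (h : CarriesNormSq e N N') (h0 : e 0 = 0) (hN : 0 < N) (hN' : 0 < N')
    {v : Fin 2 → ℤ} (hv : latticeNormSq v = N) : N ≤ N' := by
  -- The quarter turn of `v`.
  obtain ⟨w, hw⟩ : ∃ w : Fin 2 → ℤ, w = ![-v 1, v 0] := ⟨_, rfl⟩
  have hwN : latticeNormSq w = N := by
    rw [← hv, hw]
    simp [latticeNormSq, add_comm]
  have hdet : v 0 * w 1 - v 1 * w 0 = N := by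
    rw [← hv, hw]
    simp [latticeNormSq, sq]
  have hli : LinearIndependent ℤ ![v, w] := by
    apply Matrix.linearIndependent_rows_of_det_ne_zero (A := Matrix.of ![v, w])
    rw [Matrix.det_fin_two]
    exact (hdet.trans_ne hN.ne')
  let v' : normSqSubgroup N := ⟨v, AddSubgroup.subset_closure hv⟩
  let w' : normSqSubgroup N := ⟨w, AddSubgroup.subset_closure hwN⟩
  have hli' : LinearIndependent ℤ ![v', w'] := by
    rw [LinearIndependent.pair_iff] at hli ⊢
    exact fun s t hst => hli s t (congrArg Subtype.val hst)
  have hliA : LinearIndependent ℤ ![e v, e w] := by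
    rw [LinearIndependent.pair_iff] at hli' ⊢
    intro s t hst
    apply hli' s t
    apply h.restrictHom_injective h0
    rw [map_add, map_zsmul, map_zsmul, map_zero]
    exact hst
  -- Both indices in `ℤ²` factor through the same index inside `normSqSubgroup N`; the other factors
  -- agree by `index_eq`.
  have i₁ := AddSubgroup.index_map_subtype (AddSubgroup.closure {v', w'})
  have i₂ := AddSubgroup.index_map_of_injective (AddSubgroup.closure {v', w'})
    (h.restrictHom_injective h0)
  rw [AddMonoidHom.map_closure, Set.image_pair] at i₁ i₂
  rw [h.range_restrictHom h0, ← h.index_eq, ← i₁] at i₂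
  have j₁ := index_closure_pair hli
  have j₂ := index_closure_pair hliA
  have hab : (e v 0 * e w 1 - e v 1 * e w 0).natAbs = N.natAbs :=
    j₂.symm.trans (i₂.trans (j₁.trans (by rw [hdet])))
  have hev := h.add_sub hv 0
  have hew := h.add_sub hwN 0
  rw [zero_add, h0, sub_zero] at hev hew
  have hsq : (e v 0 * e w 1 - e v 1 * e w 0) ^ 2 = N ^ 2 := Int.natAbs_eq_iff_sq_eq.mp hab
  -- Lagrange's identity: squared area plus squared inner product.
  have hlag : (e v 0 * e w 1 - e v 1 * e w 0) ^ 2 + (e v 0 * e w 0 + e v 1 * e w 1) ^ 2 =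
      N' ^ 2 := by
    rw [sq N']
    nth_rewrite 1 [← hev]
    rw [← hew]
    simp only [latticeNormSq]
    ring
  nlinarith [sq_nonneg (e v 0 * e w 0 + e v 1 * e w 1)]

theorem le (h : CarriesNormSq e N N') (hN : 0 < N) (hN' : 0 < N')
    {v : Fin 2 → ℤ} (hv : latticeNormSq v = N) : N ≤ N' := by
  have h' : CarriesNormSq (e.trans (Equiv.subRight (e 0))) N N' := fun x y => by
    rw [h]
    simp
  exact h'.le_of_map_zero (by simp) hN hN' hv

theorem eq (h : CarriesNormSq e N N') (hN : 0 < N) (hN' : 0 < N')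
    {v v' : Fin 2 → ℤ} (hv : latticeNormSq v = N) (hv' : latticeNormSq v' = N') : N = N' :=
  le_antisymm (h.le hN hN' hv) (h.symm.le hN' hN hv')

end CarriesNormSq

/-! ### Transfer to distance graphs -/

/-- The points of `integerLattice n` are the integer vectors. -/
noncomputable def integerLatticeEquiv (n : ℕ) : (Fin n → ℤ) ≃ integerLattice n :=
  Equiv.ofBijective (fun x => ⟨WithLp.toLp 2 fun i => (x i : ℝ), fun i => ⟨x i, rfl⟩⟩) <| by
    constructor
    · intro x y hxy
      ext i
      have : ((x i : ℤ) : ℝ) = y i := congrArg (fun z : integerLattice n => z.1 i) hxy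
      exact_mod_cast this
    · rintro ⟨x, hx⟩
      choose m hm using id hx
      refine ⟨m, Subtype.ext ?_⟩
      ext i
      exact (hm i).symm

theorem dist_integerLatticeEquiv_sq (x y : Fin 2 → ℤ) :
    dist (integerLatticeEquiv 2 x : EuclideanSpace ℝ (Fin 2)) (integerLatticeEquiv 2 y) ^ 2 =
      latticeNormSq (x - y) := by
  rw [EuclideanSpace.dist_eq, Real.sq_sqrt (by positivity)]
  have coe (z : Fin 2 → ℤ) (i : Fin 2) :
      (integerLatticeEquiv 2 z : EuclideanSpace ℝ (Fin 2)) i = z i := rfl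
  simp [coe, latticeNormSq, Real.dist_eq]

theorem IsRealizedDistance.exists_latticeNormSq {d : ℝ}
    (h : IsRealizedDistance (integerLattice 2) d) :
    ∃ v : Fin 2 → ℤ, (latticeNormSq v : ℝ) = d ^ 2 := by
  obtain ⟨-, x, hx, y, hy, rfl⟩ := h
  obtain ⟨a, ha⟩ := (integerLatticeEquiv 2).surjective ⟨x, hx⟩
  obtain ⟨b, hb⟩ := (integerLatticeEquiv 2).surjective ⟨y, hy⟩
  exact ⟨a - b, by rw [← dist_integerLatticeEquiv_sq, ha, hb]⟩

theorem distanceGraph_integerLattice_adj {d : ℝ} (hd : 0 < d) {N : ℤ} (hN : (N : ℝ) = d ^ 2)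
    (x y : Fin 2 → ℤ) :
    (distanceGraph (integerLattice 2) d).Adj (integerLatticeEquiv 2 x) (integerLatticeEquiv 2 y) ↔
      latticeNormSq (x - y) = N := by
  have key : dist (integerLatticeEquiv 2 x : EuclideanSpace ℝ (Fin 2))
      (integerLatticeEquiv 2 y) = d ↔ latticeNormSq (x - y) = N := by
    rw [← sq_eq_sq₀ dist_nonneg hd.le, dist_integerLatticeEquiv_sq, ← hN, Int.cast_inj]
  refine (and_iff_right_of_imp fun h hxy => ?_).trans key
  rw [hxy, dist_self] at h
  exact hd.ne h

theorem eq_of_distanceGraph_iso {d₁ d₂ : ℝ} (h₁ : IsRealizedDistance (integerLattice 2) d₁)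
    (h₂ : IsRealizedDistance (integerLattice 2) d₂)
    (φ : distanceGraph (integerLattice 2) d₁ ≃g distanceGraph (integerLattice 2) d₂) :
    d₁ = d₂ := by
  obtain ⟨v₁, hv₁⟩ := h₁.exists_latticeNormSq
  obtain ⟨v₂, hv₂⟩ := h₂.exists_latticeNormSq
  have hp₁ : 0 < latticeNormSq v₁ := by exact_mod_cast hv₁ ▸ pow_pos h₁.1 2
  have hp₂ : 0 < latticeNormSq v₂ := by exact_mod_cast hv₂ ▸ pow_pos h₂.1 2
  have hc : CarriesNormSq
      ((integerLatticeEquiv 2).trans (φ.toEquiv.trans (integerLatticeEquiv 2).symm))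
      (latticeNormSq v₁) (latticeNormSq v₂) := fun x y => by
    rw [← distanceGraph_integerLattice_adj h₁.1 hv₁, ← distanceGraph_integerLattice_adj h₂.1 hv₂]
    simpa using φ.map_adj_iff.symm
  have := hc.eq hp₁ hp₂ rfl rfl
  rw [this, hv₂] at hv₁
  exact (sq_eq_sq₀ h₁.1.le h₂.1.le).mp hv₁.symm

theorem IsRealizedDistance.of_distanceGraph_iso {n : ℕ} {S : Set (EuclideanSpace ℝ (Fin n))}
    {d d' : ℝ} (h : IsRealizedDistance S d) (hd' : 0 < d')
    (φ : distanceGraph S d ≃g distanceGraph S d') : IsRealizedDistance S d' := by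
  obtain ⟨hd, x, hx, y, hy, hxy⟩ := h
  have hadj : (distanceGraph S d).Adj ⟨x, hx⟩ ⟨y, hy⟩ := by
    refine ⟨fun he => ?_, hxy⟩
    rw [Subtype.mk.inj he, dist_self] at hxy
    exact hd.ne hxy
  exact ⟨hd', _, (φ ⟨x, hx⟩).2, _, (φ ⟨y, hy⟩).2, (φ.map_adj_iff.mpr hadj).2⟩

theorem mainTheorem2 :
    (∀ d₁ d₂ : ℝ, IsRealizedDistance (integerLattice 2) d₁ →
      IsRealizedDistance (integerLattice 2) d₂ → d₁ ≠ d₂ →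
      ¬ Nonempty (distanceGraph (integerLattice 2) d₁ ≃g distanceGraph (integerLattice 2) d₂)) ∧
    (∀ P : Set ℝ, IsDistanceIsoClass (integerLattice 2) P →
      (∃ d ∈ P, IsRealizedDistance (integerLattice 2) d) → ∃ d : ℝ, P = {d}) := by
  refine ⟨fun d₁ d₂ h₁ h₂ hne ⟨φ⟩ => hne (eq_of_distanceGraph_iso h₁ h₂ φ), ?_⟩
  rintro P ⟨d₀, -, rfl⟩ ⟨d, ⟨hd, ⟨φ⟩⟩, hr⟩
  refine ⟨d, Set.Subset.antisymm ?_ ?_⟩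
  · rintro d' ⟨hd', ⟨ψ⟩⟩
    have χ := φ.symm.trans ψ
    exact (eq_of_distanceGraph_iso hr (hr.of_distanceGraph_iso hd' χ) χ).symm
  · rintro _ rfl
    exact ⟨hd, ⟨φ⟩⟩
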